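/- Let $n\ge 2$, let $\alpha>0$, $\beta>0$ be real numbers with $\alpha\beta<n^2$, and let $\Omega=\{x\in\mathbb{R}^n:|x|<1\}$. Consider the problem $$\begin{cases}\det D^2u^1=(-u^2)^{\alpha} & \text{in }\Omega,\\ \det D^2u^2=(-u^1)^{\beta} & \text{in }\Omega,\\ u^1<0,\ u^2<0 & \text{in }\Omega,\\ u^1=u^2=0 & \text{on }\partial\Omega,\end{cases}$$ where a convex solution is a pair $(u^1,u^2)$ of functions in $C^2(\overline\Omega)$ (twice continuously differentiable up to the boundary), both convex in $\Omega$, that satisfies all these conditions. Then there is exactly one convex solution $(u^1,u^2)$. Moreover $u^1$ and $u^2$ are strictly convex in $\Omega$, radially symmetric about $0$ and strictly increasing in $|x|$: for $i=1,2$ there is a strictly increasing function $g^i$ on $[0,1]$ with $u^i(x)=g^i(|x|)$ for all $x\in\overline\Omega$, and $g^i$ is differentiable on $(0,1)$ with $(g^i)'>0$ there. -/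

import Mathlib

/-- The Hessian matrix `D²u(x)` of a real function on `ℝⁿ`, in the standard coordinates:
its `(i, j)` entry is `∂²u/∂xᵢ∂xⱼ (x)`. -/
noncomputable def hessianMatrix {n : ℕ} (u : EuclideanSpace ℝ (Fin n) → ℝ)
    (x : EuclideanSpace ℝ (Fin n)) : Matrix (Fin n) (Fin n) ℝ :=
  Matrix.of fun i j =>
    iteratedFDeriv ℝ 2 u x ![EuclideanSpace.single i 1, EuclideanSpace.single j 1]

/-- `(u₁, u₂)` is a classical convex solution of the Monge-Ampère system
`det D²u₁ = (-u₂)^α`, `det D²u₂ = (-u₁)^β`, `u₁, u₂ < 0` in the open unit ball of `ℝⁿ`,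
`u₁ = u₂ = 0` on the unit sphere. Classical means twice continuously differentiable
up to the boundary. Only the values on the closed unit ball matter. -/
structure IsConvexSolution (n : ℕ) (α β : ℝ) (u₁ u₂ : EuclideanSpace ℝ (Fin n) → ℝ) :
    Prop where
  contDiffOn₁ : ContDiffOn ℝ 2 u₁ (Metric.closedBall 0 1)
  contDiffOn₂ : ContDiffOn ℝ 2 u₂ (Metric.closedBall 0 1)
  convexOn₁ : ConvexOn ℝ (Metric.ball 0 1) u₁
  convexOn₂ : ConvexOn ℝ (Metric.ball 0 1) u₂
  det_eq₁ : ∀ x ∈ Metric.ball (0 : EuclideanSpace ℝ (Fin n)) 1,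
    (hessianMatrix u₁ x).det = (-u₂ x) ^ α
  det_eq₂ : ∀ x ∈ Metric.ball (0 : EuclideanSpace ℝ (Fin n)) 1,
    (hessianMatrix u₂ x).det = (-u₁ x) ^ β
  neg₁ : ∀ x ∈ Metric.ball (0 : EuclideanSpace ℝ (Fin n)) 1, u₁ x < 0
  neg₂ : ∀ x ∈ Metric.ball (0 : EuclideanSpace ℝ (Fin n)) 1, u₂ x < 0
  boundary₁ : ∀ x ∈ Metric.sphere (0 : EuclideanSpace ℝ (Fin n)) 1, u₁ x = 0
  boundary₂ : ∀ x ∈ Metric.sphere (0 : EuclideanSpace ℝ (Fin n)) 1, u₂ x = 0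

/-- On the closed unit ball, `u` is radially symmetric about `0` and strictly increasing in
`r = |x|`, with `du/dr > 0` for `0 < r < 1` (so the profile is differentiable there). -/
def IsRadialStrictlyIncreasing {n : ℕ} (u : EuclideanSpace ℝ (Fin n) → ℝ) : Prop :=
  ∃ g : ℝ → ℝ, (∀ x ∈ Metric.closedBall (0 : EuclideanSpace ℝ (Fin n)) 1, u x = g ‖x‖) ∧
    StrictMonoOn g (Set.Icc 0 1) ∧ ∀ r ∈ Set.Ioo (0 : ℝ) 1, 0 < deriv g r

/-! Uniqueness rests on the comparison principle `le_of_det_hessianMatrix_le` and on scaling. If `c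
v₁ ≤ u₁`, then `det D²u₂ = (-u₁)^β ≤ (-c v₁)^β = det D²(c^(β/n) v₂)`, so comparison gives `c^(β/n)
v₂ ≤ u₂`; the other equation then gives `c^θ v₁ ≤ u₁` with `θ = αβ/n² < 1`. Iterating, `c^(θ^k) →
1`, hence `v₁ ≤ u₁`, and equality follows by exchanging the solutions. A first `c` exists because
`u₁` is Lipschitz up to the sphere, so `u₁ ≥ -K(1-|x|)`, while convexity forces `v₁` below a
negative multiple of `1-|x|`.

Existence is radial. With `s = |x|²`, the equation `det D²u = F(s)` has the solution with gradient
`h(s) x`, where `h^n` is the mean of `F(|·|²)` over the ball of radius `√s`. The system thus becomes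
a fixed point equation for an order-preserving map on antitone functions into `[0,1]`. This class is
closed under suprema, so Knaster-Tarski applies (`exists_admissible_fixedPoint`). A small multiple
of `1-s` is a subsolution, again because `θ < 1`, and keeps the fixed point away from zero
(`exists_profiles`). Suprema may lose continuity, but the integral operator restores it.

The constructed solution is strictly convex, radial and increasing; by uniqueness so is every
solution. -/

/-! ### Determinants and Hessians -/

/-- The determinant strictly increases when a positive definite matrix is added to a positive
semidefinite one. -/
theorem det_lt_det_add_of_posSemidef_posDef {ι : Type*} [Fintype ι] [DecidableEq ι] [Nonempty ι]
    {A N : Matrix ι ι ℝ} (hA : A.PosSemidef) (hN : N.PosDef) : A.det < (A + N).det := by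
  obtain ⟨C, hC⟩ : ∃ C : Matrix ι ι ℝ, N = C.conjTranspose * C := by
    open scoped MatrixOrder in
    obtain ⟨C, hC⟩ := CStarAlgebra.nonneg_iff_eq_star_mul_self.mp hN.posSemidef.nonneg
    exact ⟨C, hC⟩
  have hdet : 0 < N.det := hN.det_pos
  have hCdet : N.det = C.det * C.det := by
    rw [hC, Matrix.det_mul, Matrix.det_conjTranspose]; simp
  have hCu : IsUnit C.det := by
    rw [isUnit_iff_ne_zero]; intro h; rw [hCdet, h] at hdet; simp at hdet
  -- The congruence by `C⁻¹` turns `N` into the identity, so only `det M < det (1 + M)` remains, a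
  -- statement about eigenvalues.
  set M : Matrix ι ι ℝ := (C⁻¹).conjTranspose * A * C⁻¹ with hM
  have hMps : M.PosSemidef := hA.conjTranspose_mul_mul_same _
  have hCC : C⁻¹ * C = 1 := Matrix.nonsing_inv_mul C hCu
  have hCC' : C.conjTranspose * (C⁻¹).conjTranspose = 1 := by
    rw [← Matrix.conjTranspose_mul, hCC, Matrix.conjTranspose_one]
  have hAM : A = C.conjTranspose * M * C := by
    calc A = (C.conjTranspose * (C⁻¹).conjTranspose) * A * (C⁻¹ * C) := by rw [hCC, hCC']; simp
      _ = _ := by rw [hM]; simp only [Matrix.mul_assoc]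
  have hANM : A + N = C.conjTranspose * (1 + M) * C := by
    rw [Matrix.mul_add, Matrix.add_mul, ← hAM, Matrix.mul_one, ← hC, add_comm]
  have h1 : (1 + M).det = ∏ i, (1 + hMps.isHermitian.eigenvalues i) := by
    -- The characteristic polynomial at `-1` is `det (-(1 + M))`; the signs cancel against those of
    -- the factors `-1 - λᵢ`.
    have h := Matrix.eval_charpoly M (-1)
    rw [hMps.isHermitian.charpoly_eq] at h
    have h2 : (Matrix.scalar ι (-1) - M) = -(1 + M) := by
      ext i j; simp [Matrix.scalar_apply, Matrix.diagonal, Matrix.one_apply]; split_ifs <;> ring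
    rw [h2, Matrix.det_neg, Polynomial.eval_prod] at h
    have h3 : ∏ i, (Polynomial.eval (-1 : ℝ)
        (Polynomial.X - Polynomial.C (hMps.isHermitian.eigenvalues i))) =
        (-1) ^ Fintype.card ι * ∏ i, (1 + hMps.isHermitian.eigenvalues i) := by
      rw [← Finset.card_univ, ← Finset.prod_const, ← Finset.prod_mul_distrib]
      refine Finset.prod_congr rfl fun i _ => ?_
      simp; ring
    have h4 : ((-1 : ℝ) ^ Fintype.card ι) ≠ 0 := pow_ne_zero _ (by norm_num)
    exact mul_left_cancel₀ h4 (h.symm.trans h3)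
  have h2 : M.det = ∏ i, hMps.isHermitian.eigenvalues i := by
    simpa using hMps.isHermitian.det_eq_prod_eigenvalues
  have h3 : M.det < (1 + M).det := by
    rw [h1, h2]
    have hnn := hMps.eigenvalues_nonneg
    -- The factorwise comparison of products needs positive factors, so a zero eigenvalue is treated
    -- apart.
    by_cases hz : ∃ i, hMps.isHermitian.eigenvalues i = 0
    · obtain ⟨i, hi⟩ := hz
      rw [Finset.prod_eq_zero (Finset.mem_univ i) hi]
      exact Finset.prod_pos fun j _ => by linarith [hnn j]
    · push Not at hz
      refine Finset.prod_lt_prod_of_nonempty (fun i _ => lt_of_le_of_ne (hnn i) (hz i).symm)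
        (fun i _ => by linarith) Finset.univ_nonempty
  rw [hANM]
  nth_rw 1 [hAM]
  simp only [Matrix.det_mul, Matrix.det_conjTranspose, star_trivial]
  nlinarith

/-- A twice differentiable function with nonnegative symmetric second differences in the direction
`ξ` at `x` has a nonnegative second derivative in that direction. -/
theorem fderiv_fderiv_nonneg_of_second_difference {E : Type*} [NormedAddCommGroup E]
    [NormedSpace ℝ E] {w : E → ℝ} {x ξ : E} (hw : ContDiffAt ℝ 2 w x)
    (h : ∀ᶠ t : ℝ in nhds 0, 2 * w x ≤ w (x + t • ξ) + w (x - t • ξ)) :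
    0 ≤ fderiv ℝ (fderiv ℝ w) x ξ ξ := by
  set ψ : ℝ → ℝ := fun t => w (x + t • ξ) + w (x - t • ξ) with hψ
  have hd : ∀ᶠ y in nhds x, DifferentiableAt ℝ w y := by
    filter_upwards [hw.eventually (by simp)] with y hy using hy.differentiableAt (by norm_num)
  have hcp : Filter.Tendsto (fun t : ℝ => x + t • ξ) (nhds 0) (nhds x) :=
    (show Continuous fun t : ℝ => x + t • ξ by fun_prop).tendsto' _ _ (by simp)
  have hcm : Filter.Tendsto (fun t : ℝ => x - t • ξ) (nhds 0) (nhds x) :=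
    (show Continuous fun t : ℝ => x - t • ξ by fun_prop).tendsto' _ _ (by simp)
  have lp : ∀ t : ℝ, HasDerivAt (fun t : ℝ => x + t • ξ) ξ t := fun t => by
    simpa using ((hasDerivAt_id t).smul_const ξ).const_add x
  have lm : ∀ t : ℝ, HasDerivAt (fun t : ℝ => x - t • ξ) (-ξ) t := fun t => by
    simpa using ((hasDerivAt_id t).smul_const ξ).const_sub x
  have h1 : ∀ᶠ t in nhds (0 : ℝ),
      deriv ψ t = fderiv ℝ w (x + t • ξ) ξ - fderiv ℝ w (x - t • ξ) ξ := by
    filter_upwards [hcp.eventually hd, hcm.eventually hd] with t h1 h2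
    have := (h1.hasFDerivAt.comp_hasDerivAt t (lp t)).add (h2.hasFDerivAt.comp_hasDerivAt t (lm t))
    rw [map_neg, ← sub_eq_add_neg] at this
    exact this.deriv
  have hD : DifferentiableAt ℝ (fderiv ℝ w) x :=
    (hw.fderiv_right (m := 1) (by norm_num)).differentiableAt (by norm_num)
  have h2 : deriv (deriv ψ) 0 = 2 * fderiv ℝ (fderiv ℝ w) x ξ ξ := by
    rw [Filter.EventuallyEq.deriv_eq h1]
    have a : HasFDerivAt (fun y => fderiv ℝ w y ξ) ((fderiv ℝ (fderiv ℝ w) x).flip ξ) x := by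
      simpa using hD.hasFDerivAt.clm_apply (hasFDerivAt_const ξ x)
    have b1 := a.comp_hasDerivAt_of_eq (0 : ℝ) (lp 0) (by simp)
    have b2 := a.comp_hasDerivAt_of_eq (0 : ℝ) (lm 0) (by simp)
    refine (b1.sub b2).deriv.trans ?_
    simp only [ContinuousLinearMap.flip_apply, map_neg]
    ring
  have h3 : deriv ψ 0 = 0 := by rw [h1.self_of_nhds]; simp
  -- A negative second derivative would make `0` a local maximum of `ψ`; by hypothesis it is also a
  -- local minimum, so `ψ` would be locally constant with zero second derivative.
  by_contra hneg
  push Not at hneg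
  have hψc : ContinuousAt ψ 0 := by
    have a1 : ContinuousAt w (x + (0 : ℝ) • ξ) := by simpa using hw.continuousAt
    have a2 : ContinuousAt w (x - (0 : ℝ) • ξ) := by simpa using hw.continuousAt
    exact (ContinuousAt.comp (f := fun t : ℝ => x + t • ξ) a1 (by fun_prop)).add
      (ContinuousAt.comp (f := fun t : ℝ => x - t • ξ) a2 (by fun_prop))
  have hmax : IsLocalMax ψ 0 := isLocalMax_of_deriv_deriv_neg (by rw [h2]; linarith) h3 hψc
  have hconst : ψ =ᶠ[nhds 0] fun _ => ψ 0 := by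
    filter_upwards [hmax, h] with t h1 h2
    refine le_antisymm h1 ?_
    simp only [hψ, zero_smul, add_zero, sub_zero] at h2 ⊢
    linarith
  have h4 : deriv (deriv ψ) 0 = 0 := by
    rw [Filter.EventuallyEq.deriv_eq hconst.deriv]; simp
  rw [h2] at h4
  linarith

theorem dotProduct_hessianMatrix_mulVec {n : ℕ} (u : EuclideanSpace ℝ (Fin n) → ℝ)
    (x ξ : EuclideanSpace ℝ (Fin n)) :
    (ξ : Fin n → ℝ) ⬝ᵥ (hessianMatrix u x).mulVec ξ = fderiv ℝ (fderiv ℝ u) x ξ ξ := by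
  have hξ : ξ = ∑ i, ξ i • EuclideanSpace.single i (1 : ℝ) := by
    have := (EuclideanSpace.basisFun (Fin n) ℝ).sum_repr ξ
    simpa using this.symm
  conv_rhs => rw [hξ]
  simp only [map_sum, map_smul, sum_apply,
    smul_apply, smul_eq_mul, dotProduct, Matrix.mulVec, hessianMatrix,
    Matrix.of_apply, iteratedFDeriv_two_apply, Matrix.cons_val_zero, Matrix.cons_val_one,
    Finset.mul_sum]
  rw [Finset.sum_comm]
  refine Finset.sum_congr rfl fun i _ => Finset.sum_congr rfl fun j _ => ?_
  ring

theorem hessianMatrix_isHermitian {n : ℕ} {u : EuclideanSpace ℝ (Fin n) → ℝ}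
    {x : EuclideanSpace ℝ (Fin n)} (hu : ContDiffAt ℝ 2 u x) : (hessianMatrix u x).IsHermitian := by
  ext i j
  have := hu.isSymmSndFDerivAt (by simp)
  simp only [Matrix.conjTranspose_apply, star_trivial, hessianMatrix, Matrix.of_apply,
    iteratedFDeriv_two_apply, Matrix.cons_val_zero, Matrix.cons_val_one]
  exact this _ _

theorem hessianMatrix_posSemidef_of_second_difference {n : ℕ} {u : EuclideanSpace ℝ (Fin n) → ℝ}
    {x : EuclideanSpace ℝ (Fin n)} (hu : ContDiffAt ℝ 2 u x)
    (h : ∀ ξ, ∀ᶠ t : ℝ in nhds 0, 2 * u x ≤ u (x + t • ξ) + u (x - t • ξ)) :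
    (hessianMatrix u x).PosSemidef := by
  refine Matrix.PosSemidef.of_dotProduct_mulVec_nonneg (hessianMatrix_isHermitian hu) fun ξ => ?_
  have := dotProduct_hessianMatrix_mulVec u x (WithLp.toLp 2 ξ)
  simp only [star_trivial]
  exact (fderiv_fderiv_nonneg_of_second_difference hu (h (WithLp.toLp 2 ξ))).trans_eq this.symm

theorem hessianMatrix_posSemidef_of_isLocalMin {n : ℕ} {u : EuclideanSpace ℝ (Fin n) → ℝ}
    {x : EuclideanSpace ℝ (Fin n)} (hu : ContDiffAt ℝ 2 u x) (h : IsLocalMin u x) :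
    (hessianMatrix u x).PosSemidef := by
  refine hessianMatrix_posSemidef_of_second_difference hu fun ξ => ?_
  have hcp : Filter.Tendsto (fun t : ℝ => x + t • ξ) (nhds 0) (nhds x) :=
    (show Continuous fun t : ℝ => x + t • ξ by fun_prop).tendsto' _ _ (by simp)
  have hcm : Filter.Tendsto (fun t : ℝ => x - t • ξ) (nhds 0) (nhds x) :=
    (show Continuous fun t : ℝ => x - t • ξ by fun_prop).tendsto' _ _ (by simp)
  filter_upwards [hcp.eventually h, hcm.eventually h] with t h1 h2
  linarith

theorem hessianMatrix_posSemidef_of_convexOn {n : ℕ} {u : EuclideanSpace ℝ (Fin n) → ℝ}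
    {s : Set (EuclideanSpace ℝ (Fin n))} {x : EuclideanSpace ℝ (Fin n)} (hs : s ∈ nhds x)
    (hu : ContDiffAt ℝ 2 u x) (h : ConvexOn ℝ s u) : (hessianMatrix u x).PosSemidef := by
  refine hessianMatrix_posSemidef_of_second_difference hu fun ξ => ?_
  have hcp : Filter.Tendsto (fun t : ℝ => x + t • ξ) (nhds 0) (nhds x) :=
    (show Continuous fun t : ℝ => x + t • ξ by fun_prop).tendsto' _ _ (by simp)
  have hcm : Filter.Tendsto (fun t : ℝ => x - t • ξ) (nhds 0) (nhds x) :=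
    (show Continuous fun t : ℝ => x - t • ξ by fun_prop).tendsto' _ _ (by simp)
  filter_upwards [hcp hs, hcm hs] with t h1 h2
  have := h.2 h1 h2 (show (0 : ℝ) ≤ 1 / 2 by norm_num)
    (show (0 : ℝ) ≤ 1 / 2 by norm_num) (by norm_num)
  rw [show (1 / 2 : ℝ) • (x + t • ξ) + (1 / 2 : ℝ) • (x - t • ξ) = x by module] at this
  simp only [smul_eq_mul] at this
  linarith

theorem hessianMatrix_add {n : ℕ} {u v : EuclideanSpace ℝ (Fin n) → ℝ}
    {x : EuclideanSpace ℝ (Fin n)} (hu : ContDiffAt ℝ 2 u x) (hv : ContDiffAt ℝ 2 v x) :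
    hessianMatrix (fun y => u y + v y) x = hessianMatrix u x + hessianMatrix v x := by
  ext i j
  have : iteratedFDeriv ℝ 2 (fun y => u y + v y) x = _ := iteratedFDeriv_add_apply hu hv
  simp [hessianMatrix, this]

theorem hessianMatrix_const_mul {n : ℕ} {u : EuclideanSpace ℝ (Fin n) → ℝ}
    {x : EuclideanSpace ℝ (Fin n)} (c : ℝ) (hu : ContDiffAt ℝ 2 u x) :
    hessianMatrix (fun y => c * u y) x = c • hessianMatrix u x := by
  ext i j
  have : iteratedFDeriv ℝ 2 (fun y => c * u y) x = _ := iteratedFDeriv_const_smul_apply (a := c) hu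
  simp [hessianMatrix, this]

/-- Presents the inner product as a bounded `ℝ`-bilinear map whose type carries no conjugation, so
it can serve directly as a derivative. -/
theorem exists_clm_eq_inner (E : Type*) [NormedAddCommGroup E] [InnerProductSpace ℝ E] :
    ∃ L : E →L[ℝ] E →L[ℝ] ℝ, ∀ x y, L x y = inner ℝ x y :=
  ⟨innerSL ℝ, fun _ _ => rfl⟩

theorem hessianMatrix_norm_sq {n : ℕ} (x : EuclideanSpace ℝ (Fin n)) :
    hessianMatrix (fun y : EuclideanSpace ℝ (Fin n) => ‖y‖ ^ 2) x = (2 : ℝ) • 1 := by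
  ext i j
  obtain ⟨L, hL⟩ := exists_clm_eq_inner (EuclideanSpace ℝ (Fin n))
  have h : fderiv ℝ (fun y : EuclideanSpace ℝ (Fin n) => ‖y‖ ^ 2) = (2 : ℝ) • L := by
    ext y z
    simp [fderiv_norm_sq_apply, hL]
  have h2 : fderiv ℝ (fderiv ℝ fun y : EuclideanSpace ℝ (Fin n) => ‖y‖ ^ 2) x = (2 : ℝ) • L := by
    rw [h]
    exact ((2 : ℝ) • L).fderiv
  simp only [hessianMatrix, Matrix.of_apply, iteratedFDeriv_two_apply, h2,
    Matrix.cons_val_zero, Matrix.cons_val_one]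
  simp [Matrix.one_apply, hL, EuclideanSpace.inner_single_left]

/-! ### Comparison principle -/

/-- Comparison principle for the Monge-Ampère operator on the unit ball. -/
theorem le_of_det_hessianMatrix_le {n : ℕ} (hn : n ≠ 0) {u v : EuclideanSpace ℝ (Fin n) → ℝ}
    (huc : ContinuousOn u (Metric.closedBall 0 1)) (hvc : ContinuousOn v (Metric.closedBall 0 1))
    (hu : ∀ x ∈ Metric.ball 0 1, ContDiffAt ℝ 2 u x)
    (hv : ∀ x ∈ Metric.ball 0 1, ContDiffAt ℝ 2 v x)
    (hconv : ConvexOn ℝ (Metric.ball 0 1) v)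
    (hdet : ∀ x ∈ Metric.ball 0 1, (hessianMatrix u x).det ≤ (hessianMatrix v x).det)
    (hb : ∀ x ∈ Metric.sphere 0 1, v x ≤ u x) :
    ∀ x ∈ Metric.closedBall 0 1, v x ≤ u x := by
  have : Nonempty (Fin n) := Fin.pos_iff_nonempty.mp (Nat.pos_of_ne_zero hn)
  intro x₀ hx₀
  by_contra! hlt
  -- With this `ε`, `w x₀ ≤ -2ε` while `w ≥ -ε` on the sphere, so the minimum of `w` is interior.
  -- There `D²u` equals `D²v` plus a positive definite matrix, which contradicts the order of the
  -- determinants.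
  set ε : ℝ := (v x₀ - u x₀) / 2 with hε
  have hε0 : 0 < ε := by linarith
  set w : EuclideanSpace ℝ (Fin n) → ℝ := fun x => u x + ((-1) * v x + (-ε) * ‖x‖ ^ 2) with hw
  have hwc : ContinuousOn w (Metric.closedBall 0 1) := by fun_prop
  obtain ⟨y, hy, hmin⟩ := (isCompact_closedBall (0 : EuclideanSpace ℝ (Fin n)) 1).exists_isMinOn
    ⟨x₀, hx₀⟩ hwc
  have hyx : w y ≤ w x₀ := hmin hx₀
  have hyb : y ∈ Metric.ball (0 : EuclideanSpace ℝ (Fin n)) 1 := by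
    by_contra hnb
    have hys : y ∈ Metric.sphere (0 : EuclideanSpace ℝ (Fin n)) 1 := by
      simp only [Metric.mem_closedBall, Metric.mem_ball, Metric.mem_sphere] at *
      linarith
    have h1 := hb y hys
    have h2 : ‖y‖ = 1 := by simpa using hys
    simp only [hw, h2] at hyx
    nlinarith [sq_nonneg ‖x₀‖]
  have hns : ContDiffAt ℝ 2 (fun x : EuclideanSpace ℝ (Fin n) => ‖x‖ ^ 2) y :=
    (contDiff_norm_sq ℝ).contDiffAt
  have hv' : ContDiffAt ℝ 2 (fun x => (-1) * v x) y := contDiffAt_const.mul (hv y hyb)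
  have hn' : ContDiffAt ℝ 2 (fun x : EuclideanSpace ℝ (Fin n) => (-ε) * ‖x‖ ^ 2) y :=
    contDiffAt_const.mul hns
  have hpsd : (hessianMatrix w y).PosSemidef :=
    hessianMatrix_posSemidef_of_isLocalMin ((hu y hyb).add (hv'.add hn'))
      (hmin.isLocalMin (Filter.mem_of_superset (Metric.isOpen_ball.mem_nhds hyb)
        Metric.ball_subset_closedBall))
  have hH : hessianMatrix w y = hessianMatrix u y - hessianMatrix v y - (2 * ε) • 1 := by
    rw [hw, hessianMatrix_add (hu y hyb) (hv'.add hn'), hessianMatrix_add hv' hn',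
      hessianMatrix_const_mul _ (hv y hyb), hessianMatrix_const_mul _ hns, hessianMatrix_norm_sq]
    module
  have hpd : (hessianMatrix w y + (2 * ε) • (1 : Matrix (Fin n) (Fin n) ℝ)).PosDef :=
    Matrix.PosDef.posSemidef_add hpsd (Matrix.PosDef.one.smul (by linarith))
  have hvps := hessianMatrix_posSemidef_of_convexOn (Metric.isOpen_ball.mem_nhds hyb)
    (hv y hyb) hconv
  have := det_lt_det_add_of_posSemidef_posDef hvps hpd
  rw [hH, show hessianMatrix v y + (hessianMatrix u y - hessianMatrix v y - (2 * ε) • 1 +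
    (2 * ε) • 1) = hessianMatrix u y by module] at this
  exact absurd (hdet y hyb) (not_le.mpr this)

/-! ### Linear bounds near the sphere and uniqueness -/

theorem ConvexOn.le_mul_apply_zero_of_neg {E : Type*} [NormedAddCommGroup E] [NormedSpace ℝ E]
    {v : E → ℝ} (hv : ConvexOn ℝ (Metric.ball 0 1) v) (hneg : ∀ x ∈ Metric.ball (0 : E) 1, v x < 0)
    {x : E} (hx : x ∈ Metric.ball (0 : E) 1) : v x ≤ (1 - ‖x‖) / 2 * v 0 := by
  have hr : ‖x‖ < 1 := by simpa using hx
  have hr0 : 0 ≤ ‖x‖ := norm_nonneg x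
  -- Convexity is available only in the open ball, so `x` is written as a combination of `0` and an
  -- interior point of its ray; the factor `1/2` is the price.
  have hz : (2 / (1 + ‖x‖)) • x ∈ Metric.ball (0 : E) 1 := by
    rw [mem_ball_zero_iff, norm_smul, Real.norm_of_nonneg (by positivity), div_mul_eq_mul_div,
      div_lt_one (by positivity)]
    linarith
  have h := hv.2 (Metric.mem_ball_self one_pos) hz (show (0 : ℝ) ≤ (1 - ‖x‖) / 2 by linarith)
    (show (0 : ℝ) ≤ (1 + ‖x‖) / 2 by linarith) (by ring)
  rw [smul_zero, zero_add, smul_smul, show (1 + ‖x‖) / 2 * (2 / (1 + ‖x‖)) = 1 by field_simp,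
    one_smul, smul_eq_mul, smul_eq_mul] at h
  nlinarith [hneg _ hz]

theorem LipschitzOnWith.neg_mul_le_of_eq_zero_on_sphere {E : Type*} [NormedAddCommGroup E]
    [NormedSpace ℝ E] [Nontrivial E] {u : E → ℝ} {K : NNReal}
    (hu : LipschitzOnWith K u (Metric.closedBall 0 1))
    (h0 : ∀ x ∈ Metric.sphere (0 : E) 1, u x = 0) {x : E} (hx : x ∈ Metric.closedBall (0 : E) 1) :
    -(K * (1 - ‖x‖)) ≤ u x := by
  have hr : ‖x‖ ≤ 1 := by simpa using hx
  obtain ⟨y, hy, hxy⟩ : ∃ y : E, ‖y‖ = 1 ∧ dist x y ≤ 1 - ‖x‖ := by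
    rcases eq_or_ne x 0 with rfl | hx0
    · obtain ⟨y, hy⟩ := exists_norm_eq E (zero_le_one (α := ℝ))
      exact ⟨y, hy, by simp [hy]⟩
    · have hpos : 0 < ‖x‖ := norm_pos_iff.mpr hx0
      refine ⟨‖x‖⁻¹ • x, by simp [norm_smul, hpos.ne'], ?_⟩
      rw [dist_comm, dist_eq_norm, show ‖x‖⁻¹ • x - x = (‖x‖⁻¹ - 1) • x by module, norm_smul,
        Real.norm_of_nonneg (by linarith [(one_le_inv₀ hpos).mpr hr]), sub_mul,
        inv_mul_cancel₀ hpos.ne', one_mul]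
  have h := hu.dist_le_mul x hx y (by simp [hy])
  rw [h0 y (by simp [hy]), Real.dist_eq, sub_zero] at h
  have h2 : (K : ℝ) * dist x y ≤ K * (1 - ‖x‖) := by gcongr
  linarith [neg_abs_le (u x)]

/-- One application of the comparison principle to `det D²u = (-p)^γ`, `det D²v = (-q)^γ`. -/
theorem rpow_mul_le_of_mul_le {n : ℕ} (hn : n ≠ 0) {γ c : ℝ} (hγ : 0 < γ) (hc : 0 < c)
    {u v p q : EuclideanSpace ℝ (Fin n) → ℝ}
    (hu : ContDiffOn ℝ 2 u (Metric.closedBall 0 1)) (hv : ContDiffOn ℝ 2 v (Metric.closedBall 0 1))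
    (hconv : ConvexOn ℝ (Metric.ball 0 1) v)
    (hdu : ∀ x ∈ Metric.ball 0 1, (hessianMatrix u x).det = (-p x) ^ γ)
    (hdv : ∀ x ∈ Metric.ball 0 1, (hessianMatrix v x).det = (-q x) ^ γ)
    (hp : ∀ x ∈ Metric.ball 0 1, p x < 0) (hq : ∀ x ∈ Metric.ball 0 1, q x < 0)
    (hbu : ∀ x ∈ Metric.sphere 0 1, u x = 0) (hbv : ∀ x ∈ Metric.sphere 0 1, v x = 0)
    (hpq : ∀ x ∈ Metric.ball 0 1, c * q x ≤ p x) :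
    ∀ x ∈ Metric.closedBall 0 1, c ^ (γ / n) * v x ≤ u x := by
  have hn' : (n : ℝ) ≠ 0 := by exact_mod_cast hn
  have hcpos : 0 < c ^ (γ / n) := Real.rpow_pos_of_pos hc _
  have hat : ∀ {w : EuclideanSpace ℝ (Fin n) → ℝ}, ContDiffOn ℝ 2 w (Metric.closedBall 0 1) →
      ∀ x ∈ Metric.ball 0 1, ContDiffAt ℝ 2 w x := fun hw x hx =>
    hw.contDiffAt (Filter.mem_of_superset (Metric.isOpen_ball.mem_nhds hx)
      Metric.ball_subset_closedBall)
  refine le_of_det_hessianMatrix_le hn hu.continuousOn (hv.continuousOn.const_mul _) (hat hu)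
    (fun x hx => contDiffAt_const.mul (hat hv x hx)) ?_ (fun x hx => ?_) (fun x hx => ?_)
  · exact hconv.smul hcpos.le
  · rw [hessianMatrix_const_mul _ (hat hv x hx), Matrix.det_smul, Fintype.card_fin, hdu x hx,
      hdv x hx, ← Real.rpow_natCast, ← Real.rpow_mul hc.le, div_mul_cancel₀ _ hn',
      ← Real.mul_rpow hc.le (by linarith [hq x hx])]
    exact Real.rpow_le_rpow (by linarith [hp x hx]) (by linarith [hpq x hx]) hγ.le
  · rw [hbu x hx, hbv x hx, mul_zero]

theorem IsConvexSolution.swap {n : ℕ} {α β : ℝ} {u₁ u₂ : EuclideanSpace ℝ (Fin n) → ℝ}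
    (h : IsConvexSolution n α β u₁ u₂) : IsConvexSolution n β α u₂ u₁ :=
  ⟨h.2, h.1, h.4, h.3, h.6, h.5, h.8, h.7, h.10, h.9⟩

/-- Both functions are comparable to the distance `1 - ‖x‖` to the sphere in the needed direction.
This starts the iteration in `IsConvexSolution.le`; the size of `c` is irrelevant there. -/
theorem IsConvexSolution.exists_mul_le {n : ℕ} (hn : n ≠ 0) {α β : ℝ}
    {u₁ u₂ v₁ v₂ : EuclideanSpace ℝ (Fin n) → ℝ}
    (hu : IsConvexSolution n α β u₁ u₂) (hv : IsConvexSolution n α β v₁ v₂) :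
    ∃ c > 0, ∀ x ∈ Metric.closedBall 0 1, c * v₁ x ≤ u₁ x := by
  have : Nonempty (Fin n) := Fin.pos_iff_nonempty.mp (Nat.pos_of_ne_zero hn)
  obtain ⟨K, hK⟩ := hu.contDiffOn₁.exists_lipschitzOnWith (by norm_num)
    (convex_closedBall (0 : EuclideanSpace ℝ (Fin n)) 1) (isCompact_closedBall _ _)
  have h0 : v₁ 0 < 0 := hv.neg₁ 0 (Metric.mem_ball_self one_pos)
  -- `K + 1` instead of `K` keeps the constant positive when `K = 0`; the `2` undoes the loss in the
  -- convexity bound.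
  have hc : 0 < 2 * (K + 1) / (-v₁ 0) := div_pos (by positivity) (by linarith)
  refine ⟨2 * (K + 1) / (-v₁ 0), hc, fun x hx => ?_⟩
  have h1 := hK.neg_mul_le_of_eq_zero_on_sphere hu.boundary₁ hx
  have hr : ‖x‖ ≤ 1 := by simpa using hx
  rcases hr.lt_or_eq with hlt | heq
  · have h2 := hv.convexOn₁.le_mul_apply_zero_of_neg hv.neg₁ (x := x) (by simpa using hlt)
    have h3 := mul_le_mul_of_nonneg_left h2 hc.le
    have h4 : 2 * ((K : ℝ) + 1) / (-v₁ 0) * ((1 - ‖x‖) / 2 * v₁ 0) = -((K + 1) * (1 - ‖x‖)) := by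
      have := h0.ne
      field_simp
    nlinarith
  · rw [hv.boundary₁ x (by simpa using heq), hu.boundary₁ x (by simpa using heq), mul_zero]

theorem IsConvexSolution.le {n : ℕ} (hn : n ≠ 0) {α β : ℝ} (hα : 0 < α) (hβ : 0 < β)
    (hαβ : α * β < (n : ℝ) ^ 2) {u₁ u₂ v₁ v₂ : EuclideanSpace ℝ (Fin n) → ℝ}
    (hu : IsConvexSolution n α β u₁ u₂) (hv : IsConvexSolution n α β v₁ v₂) :
    ∀ x ∈ Metric.closedBall 0 1, v₁ x ≤ u₁ x := by
  have hn0 : (0 : ℝ) < n := by exact_mod_cast Nat.pos_of_ne_zero hn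
  obtain ⟨c, hc, hcu⟩ := hu.exists_mul_le hn hv
  -- One pass through both equations raises the comparison constant to the power `θ`.
  set θ : ℝ := β / n * (α / n) with hθ
  have hθ0 : 0 ≤ θ := by positivity
  have hθ1 : θ < 1 := by
    rw [hθ, div_mul_div_comm, div_lt_one (by positivity)]; nlinarith
  have key : ∀ k : ℕ, ∀ x ∈ Metric.closedBall 0 1, c ^ (θ ^ k) * v₁ x ≤ u₁ x := by
    intro k
    induction k with
    | zero => simpa using hcu
    | succ k ih =>
      have h1 := rpow_mul_le_of_mul_le hn hβ (Real.rpow_pos_of_pos hc (θ ^ k)) hu.contDiffOn₂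
        hv.contDiffOn₂ hv.convexOn₂ hu.det_eq₂ hv.det_eq₂ hu.neg₁ hv.neg₁ hu.boundary₂ hv.boundary₂
        fun x hx => ih x (Metric.ball_subset_closedBall hx)
      have h2 := rpow_mul_le_of_mul_le hn hα
        (Real.rpow_pos_of_pos (Real.rpow_pos_of_pos hc (θ ^ k)) _) hu.contDiffOn₁
        hv.contDiffOn₁ hv.convexOn₁ hu.det_eq₁ hv.det_eq₁ hu.neg₂ hv.neg₂ hu.boundary₁ hv.boundary₁
        fun x hx => h1 x (Metric.ball_subset_closedBall hx)
      rwa [← Real.rpow_mul hc.le, ← Real.rpow_mul hc.le, mul_assoc, ← hθ, ← pow_succ] at h2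
  intro x hx
  have ht : Filter.Tendsto (fun k : ℕ => c ^ (θ ^ k) * v₁ x) Filter.atTop
      (nhds (c ^ (0 : ℝ) * v₁ x)) :=
    (tendsto_const_nhds.rpow (tendsto_pow_atTop_nhds_zero_of_lt_one hθ0 hθ1)
      (Or.inl hc.ne')).mul_const _
  rw [Real.rpow_zero, one_mul] at ht
  exact le_of_tendsto' ht fun k => key k x hx

theorem IsConvexSolution.eqOn {n : ℕ} (hn : n ≠ 0) {α β : ℝ} (hα : 0 < α) (hβ : 0 < β)
    (hαβ : α * β < (n : ℝ) ^ 2) {u₁ u₂ v₁ v₂ : EuclideanSpace ℝ (Fin n) → ℝ}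
    (hu : IsConvexSolution n α β u₁ u₂) (hv : IsConvexSolution n α β v₁ v₂) :
    Set.EqOn u₁ v₁ (Metric.closedBall 0 1) ∧ Set.EqOn u₂ v₂ (Metric.closedBall 0 1) := by
  have hβα : β * α < (n : ℝ) ^ 2 := by rwa [mul_comm]
  exact ⟨fun x hx => le_antisymm (hv.le hn hα hβ hαβ hu x hx) (hu.le hn hα hβ hαβ hv x hx),
    fun x hx => le_antisymm (hv.swap.le hn hβ hα hβα hu.swap x hx)
      (hu.swap.le hn hβ hα hβα hv.swap x hx)⟩

/-! ### Solving the radial equation by integration -/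

/-- The mean over the ball of radius `√s` in `ℝⁿ` of the radial function `x ↦ F (|x|²)`. -/
noncomputable def radialMean (n : ℕ) (F : ℝ → ℝ) (s : ℝ) : ℝ :=
  n * ∫ t in (0 : ℝ)..1, t ^ (n - 1) * F (s * t ^ 2)

/-- The function `h` such that `h (|x|²) x` is the gradient of the radial convex solution of
`det D²u = F (|x|²)`. -/
noncomputable def radialSlope (n : ℕ) (F : ℝ → ℝ) (s : ℝ) : ℝ := radialMean n F s ^ (1 / n : ℝ)

/-- `x ↦ -radialPotential n F (|x|²)` is the radial solution of `det D²u = F (|x|²)` vanishing on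
the unit sphere. -/
noncomputable def radialPotential (n : ℕ) (F : ℝ → ℝ) (s : ℝ) : ℝ :=
  1 / 2 * ∫ σ in s..1, radialSlope n F σ

section radial

variable {n : ℕ} {F : ℝ → ℝ}

theorem continuous_radialMean (hF : Continuous F) : Continuous (radialMean n F) := by
  unfold radialMean
  refine continuous_const.mul ?_
  exact intervalIntegral.continuous_parametric_intervalIntegral_of_continuous'
    (f := fun s t => t ^ (n - 1) * F (s * t ^ 2)) (by fun_prop) 0 1

theorem mul_integral_pow_sub_one (hn : n ≠ 0) : (n : ℝ) * ∫ t in (0 : ℝ)..1, t ^ (n - 1) = 1 := by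
  have h : (((n - 1 : ℕ) : ℝ) + 1) = n := by
    have : n - 1 + 1 = n := by omega
    exact_mod_cast this
  have hn' : (n : ℝ) ≠ 0 := by exact_mod_cast hn
  rw [integral_pow, h, Nat.sub_add_cancel (Nat.pos_of_ne_zero hn)]
  simp [hn, hn']

theorem radialMean_zero (hn : n ≠ 0) : radialMean n F 0 = F 0 := by
  simp only [radialMean, zero_mul, intervalIntegral.integral_mul_const]
  rw [← mul_assoc, mul_integral_pow_sub_one hn, one_mul]

/-- The substitution `ρ = r t` moves the parameter from the argument of `F` to the limit of
integration. -/
theorem pow_mul_radialMean_sq (hn : n ≠ 0) (r : ℝ) :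
    r ^ n * radialMean n F (r ^ 2) = n * ∫ ρ in (0 : ℝ)..r, ρ ^ (n - 1) * F (ρ ^ 2) := by
  have h := intervalIntegral.mul_integral_comp_mul_left (a := 0) (b := 1)
    (f := fun ρ => ρ ^ (n - 1) * F (ρ ^ 2)) r
  rw [mul_zero, mul_one] at h
  rw [← h, radialMean]
  have : ∀ t : ℝ, (r * t) ^ (n - 1) * F ((r * t) ^ 2) =
      r ^ (n - 1) * (t ^ (n - 1) * F (r ^ 2 * t ^ 2)) := fun t => by
    rw [mul_pow, mul_pow]; ring
  simp only [this, intervalIntegral.integral_const_mul]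
  obtain ⟨m, rfl⟩ := Nat.exists_eq_succ_of_ne_zero hn
  simp only [Nat.succ_eq_add_one, Nat.add_sub_cancel]
  ring

/-- Once `s` occurs only in the limit of integration, the fundamental theorem of calculus applies
and `F` need only be continuous. -/
theorem hasDerivAt_radialMean (hn : n ≠ 0) (hF : Continuous F) {s : ℝ} (hs : 0 < s) :
    HasDerivAt (radialMean n F) (n / 2 * (F s - radialMean n F s) / s) s := by
  have hr : 0 < √s := Real.sqrt_pos.mpr hs
  set J : ℝ → ℝ := fun r => n * ∫ ρ in (0 : ℝ)..r, ρ ^ (n - 1) * F (ρ ^ 2) with hJ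
  have hJd : HasDerivAt J (n * (√s ^ (n - 1) * F (√s ^ 2))) √s :=
    (Continuous.integral_hasStrictDerivAt (by fun_prop) 0 √s).hasDerivAt.const_mul _
  have hsq := Real.hasDerivAt_sqrt hs.ne'
  have h1 := (hJd.comp s hsq).div (hsq.pow n) (pow_ne_zero n hr.ne')
  have hev : radialMean n F =ᶠ[nhds s] (J ∘ Real.sqrt) / (Real.sqrt ^ n) := by
    filter_upwards [lt_mem_nhds hs] with y hy
    have hy' : 0 < √y := Real.sqrt_pos.mpr hy
    have := pow_mul_radialMean_sq (F := F) hn √y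
    rw [Real.sq_sqrt hy.le] at this
    simp only [Pi.div_apply, Function.comp_apply, Pi.pow_apply, hJ]
    rw [← this]
    field_simp
  refine (h1.congr_of_eventuallyEq hev).congr_deriv ?_
  have h2 : J √s = √s ^ n * radialMean n F s := by
    have := pow_mul_radialMean_sq (F := F) hn √s
    rw [Real.sq_sqrt hs.le] at this
    exact this.symm
  simp only [Function.comp_apply, Pi.pow_apply, h2, Real.sq_sqrt hs.le]
  obtain ⟨m, rfl⟩ := Nat.exists_eq_succ_of_ne_zero hn
  simp only [Nat.succ_eq_add_one, Nat.add_sub_cancel]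
  have hss : s = √s ^ 2 := (Real.sq_sqrt hs.le).symm
  generalize radialMean (m + 1) F s = Q
  generalize F s = f
  generalize √s = r at *
  subst hss
  field_simp
  ring

theorem radialMean_pos (hn : n ≠ 0) (hF : Continuous F) (h0 : ∀ s, 0 ≤ F s)
    (h1 : ∀ s < 1, 0 < F s) (s : ℝ) : 0 < radialMean n F s := by
  have hn0 : (0 : ℝ) < n := by exact_mod_cast Nat.pos_of_ne_zero hn
  refine mul_pos hn0 (intervalIntegral.integral_pos one_pos (by fun_prop)
    (fun t ht => mul_nonneg (pow_nonneg ht.1.le _) (h0 _)) ⟨1 / (1 + |s|), ?_, ?_⟩)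
  -- The point `t = 1/(1+|s|)` satisfies `s t² < 1` for every real `s`, so the integrand is positive
  -- there.
  · exact ⟨by positivity, by rw [div_le_one (by positivity)]; linarith [abs_nonneg s]⟩
  · refine mul_pos (by positivity) (h1 _ ?_)
    rw [div_pow, one_pow, mul_one_div, div_lt_one (by positivity)]
    nlinarith [le_abs_self s, abs_nonneg s]

theorem radialSlope_pow (hn : n ≠ 0) {s : ℝ} (h : 0 ≤ radialMean n F s) :
    radialSlope n F s ^ n = radialMean n F s := by
  rw [radialSlope, one_div, Real.rpow_inv_natCast_pow h hn]

theorem continuous_radialSlope (hF : Continuous F) : Continuous (radialSlope n F) :=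
  (continuous_radialMean hF).rpow_const fun _ => Or.inr (by positivity)

/-- The coefficient of the rank one part in the Hessian of the radial solution. -/
noncomputable def radialExcess (n : ℕ) (F : ℝ → ℝ) (s : ℝ) : ℝ :=
  radialSlope n F s * (F s - radialMean n F s) / radialMean n F s

theorem hasDerivAt_radialSlope (hn : n ≠ 0) (hF : Continuous F) {s : ℝ} (hs : 0 < s)
    (hQ : 0 < radialMean n F s) :
    HasDerivAt (radialSlope n F) (radialExcess n F s / (2 * s)) s := by
  have hn' : (n : ℝ) ≠ 0 := by exact_mod_cast hn
  refine ((hasDerivAt_radialMean hn hF hs).rpow_const (Or.inl hQ.ne')).congr_deriv ?_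
  rw [Real.rpow_sub_one hQ.ne', radialExcess, radialSlope]
  field_simp

theorem hasDerivAt_radialPotential (hF : Continuous F) (s : ℝ) :
    HasDerivAt (radialPotential n F) (-(radialSlope n F s / 2)) s := by
  have := (intervalIntegral.integral_hasDerivAt_left (a := s) (b := 1)
    ((continuous_radialSlope (n := n) hF).intervalIntegrable _ _)
    (continuous_radialSlope hF).stronglyMeasurable.stronglyMeasurableAtFilter
    (continuous_radialSlope hF).continuousAt).const_mul (1 / 2)
  exact this.congr_deriv (by ring)

end radial

/-! ### Regularity, Hessian and convexity of the radial solution -/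

section radialSolution

variable {E : Type*} [NormedAddCommGroup E] [InnerProductSpace ℝ E] {n : ℕ} {F : ℝ → ℝ}
  {L : E →L[ℝ] E →L[ℝ] ℝ}

theorem hasFDerivAt_radialPotential_norm_sq (hL : ∀ x y, L x y = inner ℝ x y)
    (hF : Continuous F) (x : E) :
    HasFDerivAt (fun x : E => -radialPotential n F (‖x‖ ^ 2)) (radialSlope n F (‖x‖ ^ 2) • L x)
      x := by
  have h1 : HasFDerivAt (fun x : E => ‖x‖ ^ 2) ((2 : ℝ) • L x) x := by
    refine (hasStrictFDerivAt_norm_sq x).hasFDerivAt.congr_fderiv ?_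
    ext y
    simp [hL]
  refine ((hasDerivAt_radialPotential hF _).comp_hasFDerivAt x h1).neg.congr_fderiv ?_
  module

/-- The Hessian of the radial solution. -/
noncomputable def radialHessian (L : E →L[ℝ] E →L[ℝ] ℝ) (n : ℕ) (F : ℝ → ℝ) (x : E) :
    E →L[ℝ] E →L[ℝ] ℝ :=
  radialSlope n F (‖x‖ ^ 2) • L +
    (radialExcess n F (‖x‖ ^ 2) / ‖x‖ ^ 2) • (L x).smulRight (L x)

theorem hasFDerivAt_radialSlope_norm_sq_smul (hL : ∀ x y, L x y = inner ℝ x y) (hn : n ≠ 0)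
    (hF : Continuous F) (hQ : ∀ s, 0 < radialMean n F s) (x : E) :
    HasFDerivAt (fun x : E => radialSlope n F (‖x‖ ^ 2) • L x) (radialHessian L n F x) x := by
  rcases eq_or_ne x 0 with rfl | hx
  -- At the origin the slope need not be differentiable, but its increment tends to `0` and
  -- multiplies `L y = O(‖y‖)`, which gives `o(‖y‖)`.
  · have h1 : radialHessian L n F (0 : E) = radialSlope n F 0 • L := by
      ext; simp [radialHessian]
    rw [h1, hasFDerivAt_iff_isLittleO_nhds_zero]
    have hc : Filter.Tendsto (fun y : E => radialSlope n F (‖y‖ ^ 2) - radialSlope n F 0)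
        (nhds 0) (nhds 0) := by
      have : Continuous fun y : E => radialSlope n F (‖y‖ ^ 2) - radialSlope n F 0 :=
        ((continuous_radialSlope hF).comp (by fun_prop)).sub continuous_const
      exact this.tendsto' _ _ (by simp)
    have := ((Asymptotics.isLittleO_one_iff ℝ).mpr hc).smul_isBigO
      (L.isBigO_id (nhds (0 : E)))
    simp only [one_smul] at this
    refine this.congr_left fun y => ?_
    simp [sub_smul]
  · have hs : 0 < ‖x‖ ^ 2 := by positivity
    have h1 : HasFDerivAt (fun x : E => ‖x‖ ^ 2) ((2 : ℝ) • L x) x := by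
      refine (hasStrictFDerivAt_norm_sq x).hasFDerivAt.congr_fderiv ?_
      ext y
      simp [hL]
    have h2 := ((hasDerivAt_radialSlope hn hF hs (hQ _)).comp_hasFDerivAt x h1).smul
      (L.hasFDerivAt (x := x))
    refine h2.congr_fderiv ?_
    ext y z
    simp [radialHessian]
    field_simp

set_option maxSynthPendingDepth 3 in
theorem continuous_radialHessian (hL : ∀ x y, L x y = inner ℝ x y) (hn : n ≠ 0)
    (hF : Continuous F) (hQ : ∀ s, 0 < radialMean n F s) : Continuous (radialHessian L n F) := by
  have hH : Continuous fun x : E => radialSlope n F (‖x‖ ^ 2) :=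
    (continuous_radialSlope hF).comp (by fun_prop)
  have hK : Continuous fun x : E => radialExcess n F (‖x‖ ^ 2) := by
    have : Continuous (radialExcess n F) :=
      ((continuous_radialSlope hF).mul (hF.sub (continuous_radialMean hF))).div
        (continuous_radialMean hF) fun s => (hQ s).ne'
    exact this.comp (by fun_prop)
  have hR : Continuous fun x : E => (L x).smulRight (L x) :=
    ((ContinuousLinearMap.smulRightL ℝ E (E →L[ℝ] ℝ)).continuous.comp L.continuous).clm_apply
      L.continuous
  have hHL : Continuous fun x : E => radialSlope n F (‖x‖ ^ 2) • L := hH.smul continuous_const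
  refine hHL.add (continuous_iff_continuousAt.mpr fun x => ?_)
  rcases eq_or_ne x 0 with rfl | hx
  -- The rank one operator has norm at most `‖x‖²`, which cancels the denominator; the remaining
  -- factor vanishes at `0` because the mean there is `F 0`.
  · have h0 : radialExcess n F 0 = 0 := by simp [radialExcess, radialMean_zero hn]
    have hLx : ∀ x : E, ‖L x‖ ≤ ‖x‖ := fun x =>
      ContinuousLinearMap.opNorm_le_bound _ (norm_nonneg _) fun y => by
        rw [hL]; exact norm_inner_le_norm x y
    have hz : (radialExcess n F (‖(0 : E)‖ ^ 2) / ‖(0 : E)‖ ^ 2) • (L 0).smulRight (L 0) = 0 := by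
      ext
      simp
    have hb : ∀ x : E, ‖(radialExcess n F (‖x‖ ^ 2) / ‖x‖ ^ 2) • (L x).smulRight (L x)‖ ≤
        ‖radialExcess n F (‖x‖ ^ 2)‖ := fun x => by
      rw [norm_smul, norm_div, ContinuousLinearMap.norm_smulRight_apply, norm_pow, norm_norm]
      rcases eq_or_ne x 0 with rfl | hx
      · simp
      · have hx' : 0 < ‖x‖ := norm_pos_iff.mpr hx
        rw [div_mul_eq_mul_div, div_le_iff₀ (by positivity)]
        gcongr
        rw [sq]
        exact mul_le_mul (hLx x) (hLx x) (norm_nonneg _) (norm_nonneg _)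
    rw [ContinuousAt, hz]
    exact squeeze_zero_norm hb (hK.norm.tendsto' (0 : E) 0 (by simp [h0]))
  · exact (hK.continuousAt.div (by fun_prop) (by positivity)).smul hR.continuousAt

theorem contDiff_radialPotential_norm_sq (hn : n ≠ 0) (hF : Continuous F)
    (hQ : ∀ s, 0 < radialMean n F s) :
    ContDiff ℝ 2 fun x : E => -radialPotential n F (‖x‖ ^ 2) := by
  obtain ⟨L, hL⟩ := exists_clm_eq_inner E
  have h1 := hasFDerivAt_radialPotential_norm_sq (n := n) hL hF
  have h2 := hasFDerivAt_radialSlope_norm_sq_smul hL hn hF hQ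
  rw [show (2 : WithTop ℕ∞) = 1 + 1 by norm_num, contDiff_succ_iff_fderiv]
  refine ⟨fun x => (h1 x).differentiableAt, by simp, ?_⟩
  rw [show (fderiv ℝ fun x : E => -radialPotential n F (‖x‖ ^ 2)) = _ from
    funext fun x => (h1 x).fderiv, contDiff_one_iff_fderiv]
  refine ⟨fun x => (h2 x).differentiableAt, ?_⟩
  rw [show fderiv ℝ (fun x : E => radialSlope n F (‖x‖ ^ 2) • L x) = radialHessian L n F from
    funext fun x => (h2 x).fderiv]
  exact continuous_radialHessian hL hn hF hQ

/-- The Hessian is `H (1 + (k/H) x xᵀ)`. The matrix determinant lemma gives `H^n (1 + k‖x‖²/H)`, and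
`H^n = Q`, `k‖x‖²/H = (F - Q)/Q` for `x ≠ 0`, with `Q` the mean. -/
theorem det_hessianMatrix_radialPotential (hn : n ≠ 0) (hF : Continuous F)
    (hQ : ∀ s, 0 < radialMean n F s) (x : EuclideanSpace ℝ (Fin n)) :
    (hessianMatrix (fun x => -radialPotential n F (‖x‖ ^ 2)) x).det = F (‖x‖ ^ 2) := by
  obtain ⟨L, hL⟩ := exists_clm_eq_inner (EuclideanSpace ℝ (Fin n))
  have h1 := hasFDerivAt_radialPotential_norm_sq (n := n) hL hF
  have h2 := hasFDerivAt_radialSlope_norm_sq_smul hL hn hF hQ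
  have hD : fderiv ℝ (fderiv ℝ fun x : EuclideanSpace ℝ (Fin n) => -radialPotential n F (‖x‖ ^ 2)) x
      = radialHessian L n F x := by
    rw [show (fderiv ℝ fun x : EuclideanSpace ℝ (Fin n) => -radialPotential n F (‖x‖ ^ 2)) = _ from
      funext fun x => (h1 x).fderiv]
    exact (h2 x).fderiv
  have hpow : radialSlope n F (‖x‖ ^ 2) ^ n = radialMean n F (‖x‖ ^ 2) :=
    radialSlope_pow hn (hQ _).le
  have hH : 0 < radialSlope n F (‖x‖ ^ 2) := Real.rpow_pos_of_pos (hQ _) _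
  set H := radialSlope n F (‖x‖ ^ 2) with hHdef
  set k := radialExcess n F (‖x‖ ^ 2) / ‖x‖ ^ 2 with hk
  have hM : hessianMatrix (fun x => -radialPotential n F (‖x‖ ^ 2)) x =
      H • (1 + Matrix.replicateCol Unit ((k / H) • (x : Fin n → ℝ)) *
        Matrix.replicateRow Unit (x : Fin n → ℝ)) := by
    ext i j
    simp only [hessianMatrix, Matrix.of_apply, iteratedFDeriv_two_apply, hD, radialHessian,
      ← hHdef, ← hk]
    simp [Matrix.one_apply, hL, EuclideanSpace.inner_single_right, Matrix.mul_apply, mul_add,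
      eq_comm (a := i)]
    field_simp
  have hxx : (x : Fin n → ℝ) ⬝ᵥ (x : Fin n → ℝ) = ‖x‖ ^ 2 := by
    rw [EuclideanSpace.real_norm_sq_eq, dotProduct]
    simp [sq]
  rw [hM, Matrix.det_smul, Matrix.det_one_add_replicateCol_mul_replicateRow, Fintype.card_fin,
    dotProduct_smul, hxx, hpow, smul_eq_mul]
  rcases eq_or_ne x 0 with rfl | hx
  · simp [radialMean_zero hn]
  · have hx' : 0 < ‖x‖ := norm_pos_iff.mpr hx
    have := hQ (‖x‖ ^ 2)
    rw [hk, radialExcess, ← hHdef]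
    field_simp
    ring

theorem StrictConvexOn.comp_norm [StrictConvexSpace ℝ E] {g : ℝ → ℝ}
    (hg : StrictConvexOn ℝ (Set.Icc 0 1) g) (hm : StrictMonoOn g (Set.Icc 0 1)) :
    StrictConvexOn ℝ (Metric.ball (0 : E) 1) fun x => g ‖x‖ := by
  refine ⟨convex_ball _ _, fun x hx y hy hxy a b ha hb hab => ?_⟩
  have hI : ∀ z ∈ Metric.ball (0 : E) 1, ‖z‖ ∈ Set.Icc (0 : ℝ) 1 := fun z hz =>
    ⟨norm_nonneg z, by simpa using (mem_ball_zero_iff.mp hz).le⟩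
  have hz := hI _ (convex_ball (0 : E) 1 hx hy ha.le hb.le hab)
  -- For equal norms the profile sees no convexity; strict convexity of the ball and monotonicity of
  -- `g` take over.
  by_cases h : ‖x‖ = ‖y‖
  · have h1 := hm hz (hI y hy) (norm_combo_lt_of_ne h.le le_rfl hxy ha hb hab)
    simp only [h, smul_eq_mul, ← add_mul, hab, one_mul]
    exact h1
  · have h1 := hg.2 (hI x hx) (hI y hy) h ha hb hab
    refine lt_of_le_of_lt (hm.monotoneOn hz ?_ ?_) h1
    · exact (convex_Icc (0 : ℝ) 1) (hI x hx) (hI y hy) ha.le hb.le hab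
    · refine (norm_add_le _ _).trans_eq ?_
      simp [norm_smul, abs_of_pos ha, abs_of_pos hb]

theorem hasDerivAt_radialProfile (hF : Continuous F) (r : ℝ) :
    HasDerivAt (fun r => -radialPotential n F (r ^ 2)) (r * radialSlope n F (r ^ 2)) r := by
  refine ((hasDerivAt_radialPotential hF (r ^ 2)).comp r (hasDerivAt_pow 2 r)).neg.congr_deriv ?_
  simp
  ring

theorem strictMonoOn_radialProfile (hF : Continuous F) (hQ : ∀ s, 0 < radialMean n F s) :
    StrictMonoOn (fun r => -radialPotential n F (r ^ 2)) (Set.Icc 0 1) := by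
  have hd := hasDerivAt_radialProfile (n := n) hF
  refine strictMonoOn_of_deriv_pos (convex_Icc 0 1)
    (fun r _ => (hd r).continuousAt.continuousWithinAt) fun r hr => ?_
  rw [interior_Icc] at hr
  rw [(hd r).deriv]
  exact mul_pos hr.1 (Real.rpow_pos_of_pos (hQ _) _)

theorem strictConvexOn_radialProfile (hn : n ≠ 0) (hF : Continuous F)
    (hF1 : ∀ s < 1, 0 < F s) (hQ : ∀ s, 0 < radialMean n F s) :
    StrictConvexOn ℝ (Set.Icc 0 1) fun r => -radialPotential n F (r ^ 2) := by
  have hd := hasDerivAt_radialProfile (n := n) hF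
  have hn0 : (0 : ℝ) < n := by exact_mod_cast Nat.pos_of_ne_zero hn
  refine StrictMonoOn.strictConvexOn_of_deriv (convex_Icc 0 1)
    (fun r _ => (hd r).continuousAt.continuousWithinAt) fun a ha b hb hab => ?_
  rw [interior_Icc] at ha hb
  rw [(hd a).deriv, (hd b).deriv]
  -- The `n`-th power of the profile's derivative is `n ∫₀^r ρ^(n-1) F(ρ²) dρ`, visibly strictly
  -- increasing.
  refine lt_of_pow_lt_pow_left₀ n (mul_nonneg hb.1.le (Real.rpow_nonneg (hQ _).le _)) ?_
  rw [mul_pow, mul_pow, radialSlope_pow hn (hQ _).le, radialSlope_pow hn (hQ _).le,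
    pow_mul_radialMean_sq hn, pow_mul_radialMean_sq hn]
  refine mul_lt_mul_of_pos_left ?_ hn0
  have hc : Continuous fun ρ : ℝ => ρ ^ (n - 1) * F (ρ ^ 2) := by fun_prop
  rw [← intervalIntegral.integral_add_adjacent_intervals (hc.intervalIntegrable 0 a)
    (hc.intervalIntegrable a b)]
  refine lt_add_of_pos_right _ (intervalIntegral.intervalIntegral_pos_of_pos_on
    (hc.intervalIntegrable a b) (fun ρ hρ => ?_) hab)
  have hρ0 : 0 < ρ := ha.1.trans hρ.1
  have hρ1 : ρ < 1 := hρ.2.trans hb.2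
  exact mul_pos (pow_pos hρ0 _) (hF1 _ (by nlinarith))

theorem isRadialStrictlyIncreasing_radialPotential (hF : Continuous F)
    (hQ : ∀ s, 0 < radialMean n F s) :
    IsRadialStrictlyIncreasing
      fun x : EuclideanSpace ℝ (Fin n) => -radialPotential n F (‖x‖ ^ 2) := by
  refine ⟨fun r => -radialPotential n F (r ^ 2), fun _ _ => rfl, strictMonoOn_radialProfile hF hQ,
    fun r hr => ?_⟩
  rw [(hasDerivAt_radialProfile hF r).deriv]
  exact mul_pos hr.1 (Real.rpow_pos_of_pos (hQ _) _)

end radialSolution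

/-! ### Order-theoretic fixed point -/

/-- Profiles among which the solution of the radial problem is found. -/
def IsAdmissibleProfile (w : ℝ → ℝ) : Prop :=
  Antitone w ∧ (∀ s, 0 ≤ w s) ∧ ∀ s, w s ≤ 1

/-- Knaster-Tarski for admissible profiles. -/
theorem exists_admissible_fixedPoint {T : (ℝ → ℝ) → ℝ → ℝ}
    (hT : ∀ w, IsAdmissibleProfile w → IsAdmissibleProfile (T w))
    (hmono : ∀ v w, IsAdmissibleProfile v → IsAdmissibleProfile w → v ≤ w → T v ≤ T w)
    {w₀ : ℝ → ℝ} (hw₀ : IsAdmissibleProfile w₀) (hsub : w₀ ≤ T w₀) :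
    ∃ w, IsAdmissibleProfile w ∧ w₀ ≤ w ∧ T w = w := by
  let S : Set (ℝ → ℝ) := {w | IsAdmissibleProfile w ∧ w ≤ T w}
  have hS₀ : w₀ ∈ S := ⟨hw₀, hsub⟩
  have : Nonempty S := ⟨⟨w₀, hS₀⟩⟩
  let W : ℝ → ℝ := fun s => ⨆ w : S, (w : ℝ → ℝ) s
  have hbdd : ∀ s, BddAbove (Set.range fun w : S => (w : ℝ → ℝ) s) := fun s =>
    ⟨1, by rintro _ ⟨w, rfl⟩; exact w.2.1.2.2 s⟩
  have hle : ∀ w ∈ S, w ≤ W := fun w hw s => le_ciSup (hbdd s) (⟨w, hw⟩ : S)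
  have hW : IsAdmissibleProfile W := by
    refine ⟨fun s t hst => ciSup_mono (hbdd s) fun w => w.2.1.1 hst,
      fun s => (hw₀.2.1 s).trans (hle _ hS₀ s), fun s => ciSup_le fun w => w.2.1.2.2 s⟩
  have h1 : W ≤ T W := fun s => ciSup_le fun w =>
    (w.2.2 s).trans (hmono _ _ w.2.1 hW (hle _ w.2) s)
  have h2 : T W ≤ W := hle _ ⟨hT _ hW, hmono _ _ hW (hT _ hW) h1⟩
  exact ⟨W, hW, hle _ hS₀, le_antisymm h2 h1⟩

/-! ### Monotonicity and bounds for antitone data -/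

section antitone

variable {n : ℕ} {F G : ℝ → ℝ}

/-- Admissible profiles may be discontinuous, so integrability is drawn from monotonicity. -/
theorem intervalIntegrable_radialMean (hF : Antitone F) {s : ℝ} (hs : 0 ≤ s) :
    IntervalIntegrable (fun t => t ^ (n - 1) * F (s * t ^ 2)) MeasureTheory.volume 0 1 := by
  refine IntervalIntegrable.continuousOn_mul (AntitoneOn.intervalIntegrable ?_) (by fun_prop)
  intro a ha b hb hab
  rw [Set.uIcc_of_le zero_le_one] at ha
  exact hF (mul_le_mul_of_nonneg_left (pow_le_pow_left₀ ha.1 hab 2) hs)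

theorem radialMean_mono (hF : Antitone F) (hG : Antitone G) (h : F ≤ G) {s : ℝ} (hs : 0 ≤ s) :
    radialMean n F s ≤ radialMean n G s :=
  mul_le_mul_of_nonneg_left (intervalIntegral.integral_mono_on zero_le_one
    (intervalIntegrable_radialMean hF hs) (intervalIntegrable_radialMean hG hs)
    fun _ ht => mul_le_mul_of_nonneg_left (h _) (pow_nonneg ht.1 _)) n.cast_nonneg

theorem antitoneOn_radialMean (hF : Antitone F) : AntitoneOn (radialMean n F) (Set.Ici 0) :=
  fun _ ha _ hb hab => mul_le_mul_of_nonneg_left (intervalIntegral.integral_mono_on zero_le_one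
    (intervalIntegrable_radialMean hF hb) (intervalIntegrable_radialMean hF ha)
    fun t ht => mul_le_mul_of_nonneg_left
      (hF (mul_le_mul_of_nonneg_right hab (sq_nonneg t))) (pow_nonneg ht.1 _)) n.cast_nonneg

theorem radialMean_nonneg (h0 : ∀ s, 0 ≤ F s) (s : ℝ) : 0 ≤ radialMean n F s :=
  mul_nonneg n.cast_nonneg (intervalIntegral.integral_nonneg zero_le_one
    fun _ ht => mul_nonneg (pow_nonneg ht.1 _) (h0 _))

theorem radialMean_const (hn : n ≠ 0) (c s : ℝ) : radialMean n (fun _ => c) s = c := by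
  simp only [radialMean, intervalIntegral.integral_mul_const]
  rw [← mul_assoc, mul_integral_pow_sub_one hn, one_mul]

theorem radialMean_const_mul (c s : ℝ) :
    radialMean n (fun t => c * F t) s = c * radialMean n F s := by
  simp only [radialMean, mul_left_comm _ c, intervalIntegral.integral_const_mul]

theorem radialSlope_nonneg (h0 : ∀ s, 0 ≤ F s) (s : ℝ) : 0 ≤ radialSlope n F s :=
  Real.rpow_nonneg (radialMean_nonneg h0 s) _

theorem radialSlope_mono (hF : Antitone F) (hG : Antitone G) (h0 : ∀ s, 0 ≤ F s) (h : F ≤ G)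
    {s : ℝ} (hs : 0 ≤ s) : radialSlope n F s ≤ radialSlope n G s :=
  Real.rpow_le_rpow (radialMean_nonneg h0 s) (radialMean_mono hF hG h hs) (by positivity)

theorem antitoneOn_radialSlope (hF : Antitone F) (h0 : ∀ s, 0 ≤ F s) :
    AntitoneOn (radialSlope n F) (Set.Ici 0) := fun _ ha b hb hab =>
  Real.rpow_le_rpow (radialMean_nonneg h0 b) (antitoneOn_radialMean hF ha hb hab) (by positivity)

theorem intervalIntegrable_radialSlope (hF : Antitone F) (h0 : ∀ s, 0 ≤ F s) {a b : ℝ}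
    (ha : 0 ≤ a) (hb : 0 ≤ b) :
    IntervalIntegrable (radialSlope n F) MeasureTheory.volume a b :=
  ((antitoneOn_radialSlope hF h0).mono fun _ hx => (le_inf ha hb).trans hx.1).intervalIntegrable

theorem radialPotential_one : radialPotential n F 1 = 0 := by simp [radialPotential]

theorem radialPotential_mono (hF : Antitone F) (hG : Antitone G) (h0 : ∀ s, 0 ≤ F s) (h : F ≤ G)
    {s : ℝ} (hs : s ∈ Set.Icc (0 : ℝ) 1) : radialPotential n F s ≤ radialPotential n G s :=
  mul_le_mul_of_nonneg_left (intervalIntegral.integral_mono_on hs.2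
    (intervalIntegrable_radialSlope hF h0 hs.1 zero_le_one)
    (intervalIntegrable_radialSlope hG (fun s => (h0 s).trans (h s)) hs.1 zero_le_one)
    fun _ ht => radialSlope_mono hF hG h0 h (hs.1.trans ht.1)) (by norm_num)

theorem radialPotential_nonneg (h0 : ∀ s, 0 ≤ F s) {s : ℝ} (hs : s ≤ 1) :
    0 ≤ radialPotential n F s :=
  mul_nonneg (by norm_num) (intervalIntegral.integral_nonneg hs fun t _ => radialSlope_nonneg h0 t)

theorem antitoneOn_radialPotential (hF : Antitone F) (h0 : ∀ s, 0 ≤ F s) :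
    AntitoneOn (radialPotential n F) (Set.Icc 0 1) := fun a ha b hb hab => by
  have h1 := intervalIntegral.integral_add_adjacent_intervals
    (intervalIntegrable_radialSlope (n := n) hF h0 ha.1 hb.1)
    (intervalIntegrable_radialSlope (n := n) hF h0 hb.1 zero_le_one)
  have h2 : 0 ≤ ∫ t in a..b, radialSlope n F t :=
    intervalIntegral.integral_nonneg hab fun t _ => radialSlope_nonneg h0 t
  simp only [radialPotential]
  linarith

theorem continuousOn_radialPotential (hF : Antitone F) (h0 : ∀ s, 0 ≤ F s) :
    ContinuousOn (radialPotential n F) (Set.Icc 0 1) := by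
  have h := (intervalIntegrable_radialSlope (n := n) hF h0 le_rfl zero_le_one)
  rw [intervalIntegrable_iff_integrableOn_Icc_of_le zero_le_one,
    ← Set.uIcc_of_le zero_le_one] at h
  have := intervalIntegral.continuousOn_primitive_interval_left h
  rw [Set.uIcc_of_le zero_le_one] at this
  exact continuousOn_const.mul this

theorem radialPotential_const_mul {c : ℝ} (hc : 0 ≤ c) (h0 : ∀ s, 0 ≤ F s) (s : ℝ) :
    radialPotential n (fun t => c * F t) s = c ^ (1 / n : ℝ) * radialPotential n F s := by
  have : ∀ t, radialSlope n (fun t => c * F t) t = c ^ (1 / n : ℝ) * radialSlope n F t := fun t => by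
    rw [radialSlope, radialMean_const_mul, Real.mul_rpow hc (radialMean_nonneg h0 t), radialSlope]
  simp only [radialPotential, this, intervalIntegral.integral_const_mul]
  ring

theorem radialPotential_le_one (hn : n ≠ 0) (hF : Antitone F) (h0 : ∀ s, 0 ≤ F s)
    (h1 : ∀ s, F s ≤ 1) {s : ℝ} (hs : s ∈ Set.Icc (0 : ℝ) 1) : radialPotential n F s ≤ 1 := by
  refine (radialPotential_mono (G := fun _ => 1) hF antitone_const h0 h1 hs).trans ?_
  simp only [radialPotential, radialSlope, radialMean_const hn, Real.one_rpow,
    intervalIntegral.integral_const, smul_eq_mul, mul_one]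
  linarith [hs.1]

/-- The slope is antitone, hence at least its value at `1` on `[s, 1]`. This is the source of the
barrier `1 - s`. -/
theorem mul_one_sub_le_radialPotential (hF : Antitone F) (h0 : ∀ s, 0 ≤ F s) {s : ℝ}
    (hs : s ∈ Set.Icc (0 : ℝ) 1) : radialSlope n F 1 / 2 * (1 - s) ≤ radialPotential n F s := by
  have h : ∫ _ in s..1, radialSlope n F 1 ≤ ∫ t in s..1, radialSlope n F t :=
    intervalIntegral.integral_mono_on hs.2 (by simp)
      (intervalIntegrable_radialSlope hF h0 hs.1 zero_le_one) fun t ht =>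
      antitoneOn_radialSlope hF h0 (hs.1.trans ht.1) (Set.mem_Ici.mpr zero_le_one) ht.2
  rw [intervalIntegral.integral_const, smul_eq_mul] at h
  simp only [radialPotential]
  linarith

end antitone

/-! ### The profile map, its barrier and its fixed point -/

/-- The projection of `ℝ` onto `[0, 1]`. -/
noncomputable def unitClamp (s : ℝ) : ℝ := max 0 (min s 1)

theorem unitClamp_mem (s : ℝ) : unitClamp s ∈ Set.Icc (0 : ℝ) 1 :=
  ⟨le_max_left _ _, max_le zero_le_one (min_le_right _ _)⟩

theorem monotone_unitClamp : Monotone unitClamp := fun _ _ h =>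
  max_le_max le_rfl (min_le_min h le_rfl)

theorem continuous_unitClamp : Continuous unitClamp := by unfold unitClamp; fun_prop

theorem unitClamp_of_mem {s : ℝ} (hs : s ∈ Set.Icc (0 : ℝ) 1) : unitClamp s = s := by
  rw [unitClamp, min_eq_left hs.2, max_eq_right hs.1]

theorem unitClamp_lt_one {s : ℝ} (hs : s < 1) : unitClamp s < 1 :=
  max_lt zero_lt_one ((min_le_left _ _).trans_lt hs)

theorem Antitone.rpow_profile {w : ℝ → ℝ} (hw : Antitone w) (h0 : ∀ s, 0 ≤ w s) {γ : ℝ}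
    (hγ : 0 ≤ γ) : Antitone fun s => w s ^ γ :=
  fun _ b hab => Real.rpow_le_rpow (h0 b) (hw hab) hγ

/-- The profile of the solution of `det D²u = (-v)^γ` for `v` with profile `w`. -/
noncomputable def profileStep (n : ℕ) (γ : ℝ) (w : ℝ → ℝ) (s : ℝ) : ℝ :=
  radialPotential n (fun t => w t ^ γ) (unitClamp s)

section profileStep

variable {n : ℕ} {γ : ℝ} {v w : ℝ → ℝ}

theorem IsAdmissibleProfile.profileStep (hn : n ≠ 0) (hγ : 0 < γ) (hw : IsAdmissibleProfile w) :
    IsAdmissibleProfile (profileStep n γ w) := by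
  have h0 : ∀ s, 0 ≤ w s ^ γ := fun s => Real.rpow_nonneg (hw.2.1 s) _
  have hA := hw.1.rpow_profile hw.2.1 hγ.le
  exact ⟨fun a b hab => antitoneOn_radialPotential hA h0 (unitClamp_mem a) (unitClamp_mem b)
      (monotone_unitClamp hab),
    fun s => radialPotential_nonneg h0 (unitClamp_mem s).2,
    fun s => radialPotential_le_one hn hA h0
      (fun t => Real.rpow_le_one (hw.2.1 t) (hw.2.2 t) hγ.le) (unitClamp_mem s)⟩

theorem profileStep_mono (hγ : 0 < γ) (hv : IsAdmissibleProfile v) (hw : IsAdmissibleProfile w)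
    (h : v ≤ w) : profileStep n γ v ≤ profileStep n γ w := fun s =>
  radialPotential_mono (hv.1.rpow_profile hv.2.1 hγ.le) (hw.1.rpow_profile hw.2.1 hγ.le)
    (fun t => Real.rpow_nonneg (hv.2.1 t) _)
    (fun t => Real.rpow_le_rpow (hv.2.1 t) (h t) hγ.le) (unitClamp_mem s)

theorem continuous_profileStep (hγ : 0 < γ) (hw : IsAdmissibleProfile w) :
    Continuous (profileStep n γ w) :=
  (continuousOn_radialPotential (hw.1.rpow_profile hw.2.1 hγ.le)
    (fun t => Real.rpow_nonneg (hw.2.1 t) _)).comp_continuous continuous_unitClamp unitClamp_mem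

theorem isAdmissibleProfile_const_mul_one_sub {c : ℝ} (hc : 0 ≤ c) (hc1 : c ≤ 1) :
    IsAdmissibleProfile fun s => c * (1 - unitClamp s) :=
  ⟨fun _ _ hab => mul_le_mul_of_nonneg_left (sub_le_sub_left (monotone_unitClamp hab) 1) hc,
    fun s => mul_nonneg hc (by linarith [(unitClamp_mem s).2]),
    fun s => mul_le_one₀ hc1 (by linarith [(unitClamp_mem s).2])
      (by linarith [(unitClamp_mem s).1])⟩

/-- The lower barrier `s ↦ 1 - s` is reproduced up to a constant. -/
theorem exists_barrier_le_profileStep (hn : n ≠ 0) (hγ : 0 < γ) :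
    ∃ C > 0, C ≤ 1 ∧ ∀ c, 0 ≤ c → ∀ s, c ^ (γ / n) * C * (1 - unitClamp s) ≤
      profileStep n γ (fun s => c * (1 - unitClamp s)) s := by
  have hφ : IsAdmissibleProfile fun s => 1 * (1 - unitClamp s) :=
    isAdmissibleProfile_const_mul_one_sub zero_le_one le_rfl
  simp only [one_mul] at hφ
  have h0 : ∀ s, 0 ≤ (1 - unitClamp s) ^ γ := fun s => Real.rpow_nonneg (hφ.2.1 s) _
  have hA := hφ.1.rpow_profile hφ.2.1 hγ.le
  set C := radialSlope n (fun s => (1 - unitClamp s) ^ γ) 1 / 2 with hC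
  have hlow : ∀ s ∈ Set.Icc (0 : ℝ) 1, C * (1 - s) ≤
      radialPotential n (fun s => (1 - unitClamp s) ^ γ) s := fun s hs =>
    mul_one_sub_le_radialPotential hA h0 hs
  refine ⟨C, ?_, ?_, fun c hc s => ?_⟩
  · refine half_pos (Real.rpow_pos_of_pos (radialMean_pos hn ?_ h0 (fun s hs => ?_) 1) _)
    · exact (continuous_const.sub continuous_unitClamp).rpow_const fun _ => Or.inr hγ.le
    · exact Real.rpow_pos_of_pos (by linarith [unitClamp_lt_one hs]) _
  · have h1 := hlow 0 ⟨le_rfl, zero_le_one⟩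
    have h2 := radialPotential_le_one hn hA h0
      (fun t => Real.rpow_le_one (hφ.2.1 t) (hφ.2.2 t) hγ.le) (s := 0) ⟨le_rfl, zero_le_one⟩
    linarith
  -- Homogeneity: `c^γ` leaves the mean, and the root turns it into `c^(γ/n)`.
  · have h1 : (fun t => (c * (1 - unitClamp t)) ^ γ) = fun t => c ^ γ * (1 - unitClamp t) ^ γ :=
      funext fun t => Real.mul_rpow hc (hφ.2.1 t)
    rw [profileStep, h1, radialPotential_const_mul (Real.rpow_nonneg hc _) h0, ← Real.rpow_mul hc,
      mul_one_div, mul_assoc]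
    exact mul_le_mul_of_nonneg_left (hlow _ (unitClamp_mem s)) (Real.rpow_nonneg hc _)

end profileStep

theorem exists_profiles {n : ℕ} (hn : n ≠ 0) {α β : ℝ} (hα : 0 < α) (hβ : 0 < β)
    (hαβ : α * β < (n : ℝ) ^ 2) :
    ∃ w₁ w₂ : ℝ → ℝ, IsAdmissibleProfile w₁ ∧ IsAdmissibleProfile w₂ ∧
      profileStep n α w₂ = w₁ ∧ profileStep n β w₁ = w₂ ∧
      (∀ s < 1, 0 < w₁ s) ∧ ∀ s < 1, 0 < w₂ s := by
  have hn0 : (0 : ℝ) < n := by exact_mod_cast Nat.pos_of_ne_zero hn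
  obtain ⟨A, hA0, hA1, hA⟩ := exists_barrier_le_profileStep hn hα
  obtain ⟨B, hB0, hB1, hB⟩ := exists_barrier_le_profileStep hn hβ
  set θ : ℝ := β / n * (α / n) with hθ
  have hθ1 : θ < 1 := by
    rw [hθ, div_mul_div_comm, div_lt_one (by positivity)]; nlinarith
  set D : ℝ := B ^ (α / n) * A with hD
  have hD0 : 0 < D := by positivity
  have hD1 : D ≤ 1 := mul_le_one₀ (Real.rpow_le_one hB0.le hB1 (by positivity)) hA0.le hA1
  -- Two steps send the barrier of height `ε` to at least height `ε^θ D`; this `ε` solves `ε = ε^θ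
  -- D`. Since `D ≤ 1`, also `ε ≤ 1`, as admissibility requires.
  set ε : ℝ := D ^ (1 / (1 - θ)) with hε
  have hε0 : 0 < ε := Real.rpow_pos_of_pos hD0 _
  have hθ' : 0 < 1 - θ := by linarith
  have hε1 : ε ≤ 1 := Real.rpow_le_one hD0.le hD1 (by positivity)
  have hεD : ε = ε ^ θ * D := by
    have h : ε ^ (1 - θ) = D := by
      rw [hε, ← Real.rpow_mul hD0.le, one_div_mul_cancel hθ'.ne', Real.rpow_one]
    conv_rhs => rw [← h, ← Real.rpow_add hε0]
    simp
  have hbar : ∀ {c : ℝ}, 0 ≤ c → c ≤ 1 → IsAdmissibleProfile fun s => c * (1 - unitClamp s) :=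
    fun hc hc1 => isAdmissibleProfile_const_mul_one_sub hc hc1
  set c := ε ^ (β / n) * B with hc
  have hc0 : 0 < c := by positivity
  have hc1 : c ≤ 1 := mul_le_one₀ (Real.rpow_le_one hε0.le hε1 (by positivity)) hB0.le hB1
  have hsub₂ : (fun s => c * (1 - unitClamp s)) ≤
      profileStep n β fun s => ε * (1 - unitClamp s) := fun s => hB ε hε0.le s
  have hcε : c ^ (α / n) * A = ε := by
    conv_rhs => rw [hεD, hD, hθ]
    rw [hc, Real.mul_rpow (Real.rpow_nonneg hε0.le _) hB0.le, ← Real.rpow_mul hε0.le, mul_assoc]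
  have hsub₁ : (fun s => ε * (1 - unitClamp s)) ≤
      profileStep n α fun s => c * (1 - unitClamp s) := fun s => by
    have := hA c hc0.le s
    rwa [hcε] at this
  have hadm₂ : ∀ {w}, IsAdmissibleProfile w → IsAdmissibleProfile (profileStep n β w) :=
    fun h => h.profileStep hn hβ
  obtain ⟨w, hw, hεw, hfix⟩ := exists_admissible_fixedPoint
    (T := fun w => profileStep n α (profileStep n β w))
    (fun w hw => (hadm₂ hw).profileStep hn hα)
    (fun v w hv hw hvw => profileStep_mono hα (hadm₂ hv) (hadm₂ hw) (profileStep_mono hβ hv hw hvw))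
    (hbar hε0.le hε1)
    (hsub₁.trans (profileStep_mono hα (hbar hc0.le hc1) (hadm₂ (hbar hε0.le hε1)) hsub₂))
  have hpos : ∀ {s : ℝ}, s < 1 → 0 < 1 - unitClamp s := fun hs => by linarith [unitClamp_lt_one hs]
  refine ⟨w, profileStep n β w, hw, hadm₂ hw, hfix, rfl, fun s hs => ?_, fun s hs => ?_⟩
  · exact (mul_pos hε0 (hpos hs)).trans_le (hεw s)
  · exact (mul_pos hc0 (hpos hs)).trans_le
      ((hsub₂.trans (profileStep_mono hβ (hbar hε0.le hε1) hw hεw)) s)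

/-! ### Existence and conclusion -/

/-- Existence of a radial solution. -/
theorem exists_radial_isConvexSolution {n : ℕ} (hn : n ≠ 0) {α β : ℝ} (hα : 0 < α) (hβ : 0 < β)
    (hαβ : α * β < (n : ℝ) ^ 2) :
    ∃ u₁ u₂ : EuclideanSpace ℝ (Fin n) → ℝ, IsConvexSolution n α β u₁ u₂ ∧
      (StrictConvexOn ℝ (Metric.ball 0 1) u₁ ∧ StrictConvexOn ℝ (Metric.ball 0 1) u₂) ∧
      IsRadialStrictlyIncreasing u₁ ∧ IsRadialStrictlyIncreasing u₂ := by
  obtain ⟨w₁, w₂, hw₁, hw₂, h₁, h₂, hpos₁, hpos₂⟩ := exists_profiles hn hα hβ hαβ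
  -- Each profile is an image of the integral operator, hence continuous although found as a
  -- supremum or derived from one.
  have hc₁ : Continuous w₁ := h₁ ▸ continuous_profileStep hα hw₂
  have hc₂ : Continuous w₂ := h₂ ▸ continuous_profileStep hβ hw₁
  have hF₁ : Continuous fun s => w₂ s ^ α := hc₂.rpow_const fun _ => Or.inr hα.le
  have hF₂ : Continuous fun s => w₁ s ^ β := hc₁.rpow_const fun _ => Or.inr hβ.le
  have hp₁ : ∀ s < 1, 0 < w₂ s ^ α := fun s hs => Real.rpow_pos_of_pos (hpos₂ s hs) _
  have hp₂ : ∀ s < 1, 0 < w₁ s ^ β := fun s hs => Real.rpow_pos_of_pos (hpos₁ s hs) _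
  have hQ₁ := radialMean_pos hn hF₁ (fun s => Real.rpow_nonneg (hw₂.2.1 s) _) hp₁
  have hQ₂ := radialMean_pos hn hF₂ (fun s => Real.rpow_nonneg (hw₁.2.1 s) _) hp₂
  have hI : ∀ x ∈ Metric.ball (0 : EuclideanSpace ℝ (Fin n)) 1, 0 ≤ ‖x‖ ^ 2 ∧ ‖x‖ ^ 2 < 1 :=
    fun x hx => by
      have : ‖x‖ < 1 := by simpa using hx
      exact ⟨by positivity, by nlinarith [norm_nonneg x]⟩
  have he₁ : ∀ x ∈ Metric.ball (0 : EuclideanSpace ℝ (Fin n)) 1,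
      radialPotential n (fun s => w₂ s ^ α) (‖x‖ ^ 2) = w₁ (‖x‖ ^ 2) := fun x hx => by
    rw [← h₁, profileStep, unitClamp_of_mem ⟨(hI x hx).1, (hI x hx).2.le⟩]
  have he₂ : ∀ x ∈ Metric.ball (0 : EuclideanSpace ℝ (Fin n)) 1,
      radialPotential n (fun s => w₁ s ^ β) (‖x‖ ^ 2) = w₂ (‖x‖ ^ 2) := fun x hx => by
    rw [← h₂, profileStep, unitClamp_of_mem ⟨(hI x hx).1, (hI x hx).2.le⟩]
  have hsc₁ : StrictConvexOn ℝ (Metric.ball (0 : EuclideanSpace ℝ (Fin n)) 1) _ :=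
    (strictConvexOn_radialProfile hn hF₁ hp₁ hQ₁).comp_norm (strictMonoOn_radialProfile hF₁ hQ₁)
  have hsc₂ : StrictConvexOn ℝ (Metric.ball (0 : EuclideanSpace ℝ (Fin n)) 1) _ :=
    (strictConvexOn_radialProfile hn hF₂ hp₂ hQ₂).comp_norm (strictMonoOn_radialProfile hF₂ hQ₂)
  refine ⟨_, _, ⟨(contDiff_radialPotential_norm_sq hn hF₁ hQ₁).contDiffOn,
    (contDiff_radialPotential_norm_sq hn hF₂ hQ₂).contDiffOn, hsc₁.convexOn, hsc₂.convexOn,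
    fun x hx => ?_, fun x hx => ?_, fun x hx => ?_, fun x hx => ?_, fun x hx => ?_,
    fun x hx => ?_⟩, ⟨hsc₁, hsc₂⟩, isRadialStrictlyIncreasing_radialPotential hF₁ hQ₁,
    isRadialStrictlyIncreasing_radialPotential hF₂ hQ₂⟩
  · rw [det_hessianMatrix_radialPotential hn hF₁ hQ₁, neg_neg, he₂ x hx]
  · rw [det_hessianMatrix_radialPotential hn hF₂ hQ₂, neg_neg, he₁ x hx]
  · rw [he₁ x hx, neg_lt_zero]
    exact hpos₁ _ (hI x hx).2
  · rw [he₂ x hx, neg_lt_zero]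
    exact hpos₂ _ (hI x hx).2
  · rw [mem_sphere_zero_iff_norm.mp hx, one_pow, radialPotential_one, neg_zero]
  · rw [mem_sphere_zero_iff_norm.mp hx, one_pow, radialPotential_one, neg_zero]

theorem IsRadialStrictlyIncreasing.congr {n : ℕ} {u v : EuclideanSpace ℝ (Fin n) → ℝ}
    (hu : IsRadialStrictlyIncreasing u) (h : Set.EqOn v u (Metric.closedBall 0 1)) :
    IsRadialStrictlyIncreasing v := by
  obtain ⟨g, hg, hg'⟩ := hu
  exact ⟨g, fun x hx => (h hx).trans (hg x hx), hg'⟩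

theorem theorem5p2 (n : ℕ) (hn : 2 ≤ n) (α β : ℝ) (hα : 0 < α) (hβ : 0 < β)
    (hαβ : α * β < (n : ℝ) ^ 2) :
    (∃ u₁ u₂ : EuclideanSpace ℝ (Fin n) → ℝ, IsConvexSolution n α β u₁ u₂) ∧
    (∀ u₁ u₂ v₁ v₂ : EuclideanSpace ℝ (Fin n) → ℝ,
      IsConvexSolution n α β u₁ u₂ → IsConvexSolution n α β v₁ v₂ →
        Set.EqOn u₁ v₁ (Metric.closedBall 0 1) ∧ Set.EqOn u₂ v₂ (Metric.closedBall 0 1)) ∧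
    (∀ u₁ u₂ : EuclideanSpace ℝ (Fin n) → ℝ, IsConvexSolution n α β u₁ u₂ →
      (StrictConvexOn ℝ (Metric.ball 0 1) u₁ ∧ StrictConvexOn ℝ (Metric.ball 0 1) u₂) ∧
      IsRadialStrictlyIncreasing u₁ ∧ IsRadialStrictlyIncreasing u₂) := by
  have hn0 : n ≠ 0 := by omega
  obtain ⟨u₁, u₂, hu, ⟨hs₁, hs₂⟩, hr₁, hr₂⟩ := exists_radial_isConvexSolution hn0 hα hβ hαβ
  refine ⟨⟨u₁, u₂, hu⟩, fun _ _ _ _ hu hv => hu.eqOn hn0 hα hβ hαβ hv, fun v₁ v₂ hv => ?_⟩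
  obtain ⟨h₁, h₂⟩ := hv.eqOn hn0 hα hβ hαβ hu
  exact ⟨⟨hs₁.congr (h₁.mono Metric.ball_subset_closedBall).symm,
    hs₂.congr (h₂.mono Metric.ball_subset_closedBall).symm⟩, hr₁.congr h₁, hr₂.congr h₂⟩
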